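/- Let $d\ge 2$, let $V=\mathbb R^d$, and let $C$ be a compact connected Lie subgroup of $GL(V)$ (equivalently, a compact connected subgroup of $GL(V)$) such that the only $v\in V$ with $gv=v$ for all $g\in C$ is $v=0$. Let $\lambda$ be a Borel probability measure on $V$ which is $C$-invariant, i.e. $g_*\lambda=\lambda$ for all $g\in C$, and suppose that $\lambda(W)=0$ for every vector subspace $W\subsetneq V$. Then the $d$-fold convolution power $\lambda^{d}=\lambda*\cdots*\lambda$ ($d$ factors) has a density with respect to Lebesgue measure on $V$; moreover the Fourier transform $\widehat\lambda(\xi)=\int_V e^{i\langle x,\xi\rangle}\,d\lambda(x)$ vanishes at infinity, i.e. $\widehat\lambda(\xi)\to 0$ as $\|\xi\|\to\infty$. -/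

import Mathlib

open MeasureTheory Filter Topology

/-- The `n`-fold (additive) convolution power of a measure: `λ⁰ = δ₀`, `λⁿ⁺¹ = λⁿ ∗ λ`. -/
noncomputable def convPower {V : Type*} [AddMonoid V] [MeasurableSpace V] (μ : Measure V) :
    ℕ → Measure V
  | 0 => Measure.dirac 0
  | n + 1 => Measure.conv (convPower μ n) μ

/-! Let `X i` generate one-parameter subgroups of `C`. By invariance, the sum of `d` independent
vectors `v i` has the law of `∑ i, exp (s i • X i) (v i)` for every `s`. Where the `X i (v i)` are
independent, differentiating in `s` gives an invertible map, so null sets pull back to null sets;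
Fubini in `(s, v)` then makes the sum avoid a null set almost surely (`pi_sum_mem_null_eq_zero`).

Such `X i` exist for almost every tuple because the images of the generators lie in no common proper
subspace: a functional killing them all would be `C`-invariant, hence zero by Haar averaging. That
passage from generators to `C` is `le_of_oneParam`, a hands-on substitute for Lie theory.

Decay follows from Riemann–Lebesgue, since the transform of the convolution power is the `d`-th
power of that of `μ`. -/

/-- The directions of the one-parameter subgroups contained in a group `C` of units. -/
def oneParam {A : Type*} [NormedRing A] [NormedAlgebra ℝ A] (C : Subgroup Aˣ) : Set A :=
  {X | ∀ t : ℝ, ∃ g ∈ C, g.val = NormedSpace.exp (t • X)}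

/-! ### One-parameter subgroups of compact matrix groups -/

section Units

theorem isClosed_image_val {A : Type*} [NormedRing A] {C : Subgroup Aˣ} (hC : IsCompact (C : Set Aˣ)) :
    IsClosed (Units.val '' (C : Set Aˣ)) :=
  (hC.image Units.continuous_val).isClosed

variable {A : Type*} [NormedRing A] [NormedAlgebra ℝ A] [CompleteSpace A]

theorem continuous_exp_real : Continuous (NormedSpace.exp : A → A) := by
  let := NormedAlgebra.restrictScalars ℚ ℝ A
  exact NormedSpace.exp_continuous

theorem exp_mul_exp_neg_self (X : A) : NormedSpace.exp X * NormedSpace.exp (-X) = 1 := by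
  let := NormedAlgebra.restrictScalars ℚ ℝ A
  rw [← NormedSpace.exp_add_of_commute (Commute.refl X).neg_right, add_neg_cancel,
    NormedSpace.exp_zero]

theorem exp_neg_mul_exp_self (X : A) : NormedSpace.exp (-X) * NormedSpace.exp X = 1 := by
  simpa using exp_mul_exp_neg_self (-X)

variable (A) in
theorem exists_local_log : ∃ l : A → A, HasFDerivAt l (1 : A →L[ℝ] A) 1 ∧ l 1 = 0 ∧
    ∀ᶠ y in 𝓝 (1 : A), NormedSpace.exp (l y) = y := by
  have h : HasStrictFDerivAt (NormedSpace.exp : A → A)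
      ((ContinuousLinearEquiv.refl ℝ A : A ≃L[ℝ] A) : A →L[ℝ] A) 0 :=
    hasStrictFDerivAt_exp_zero
  refine ⟨h.localInverse _ _ _, ?_, ?_, ?_⟩
  · have := h.to_localInverse.hasFDerivAt
    rw [NormedSpace.exp_zero] at this
    exact this
  · have := h.localInverse_apply_image
    rwa [NormedSpace.exp_zero] at this
  · have := h.eventually_right_inverse
    rwa [NormedSpace.exp_zero] at this

/-- A limit of the directions in which elements of a compact group `C` approach the identity is
the direction of a one-parameter subgroup of `C`. -/
theorem mem_oneParam_of_tendsto {C : Subgroup Aˣ} (hC : IsCompact (C : Set Aˣ))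
    {g : ℕ → Aˣ} (hg : ∀ n, g n ∈ C) (hne : ∀ n, (g n).val ≠ 1)
    (h1 : Tendsto (fun n => (g n).val - 1) atTop (𝓝 0)) {X : A}
    (hX : Tendsto (fun n => ‖(g n).val - 1‖⁻¹ • ((g n).val - 1)) atTop (𝓝 X)) :
    X ∈ oneParam C := by
  let := NormedAlgebra.restrictScalars ℚ ℝ A
  obtain ⟨l, hl, hl1, hexp⟩ := exists_local_log A
  -- The local logarithm has derivative the identity at `1`, so it has the same limiting direction.
  have hlog : Tendsto (fun n => ‖(g n).val - 1‖⁻¹ • l (g n).val) atTop (𝓝 X) := by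
    have := hl.hasFDerivWithinAt (s := Set.univ) |>.lim h1 (by simp) hX
    simpa [hl1] using this
  have hr : Tendsto (fun n => ‖(g n).val - 1‖⁻¹) atTop atTop := by
    apply Tendsto.inv_tendsto_nhdsGT_zero
    rw [tendsto_nhdsWithin_iff]
    refine ⟨by simpa using h1.norm, Eventually.of_forall fun n => ?_⟩
    simpa [sub_eq_zero] using hne n
  have hg1 : Tendsto (fun n => (g n).val) atTop (𝓝 1) := by
    simpa using h1.add_const 1
  have key : ∀ t : ℝ, 0 ≤ t → ∃ h ∈ C, h.val = NormedSpace.exp (t • X) := by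
    intro t ht
    have hk : Tendsto (fun n => (⌊t * ‖(g n).val - 1‖⁻¹⌋₊ : ℝ) / ‖(g n).val - 1‖⁻¹) atTop (𝓝 t) :=
      (tendsto_nat_floor_mul_div_atTop ht).comp hr
    -- These exponentials are eventually the powers `g n ^ ⌊t / ‖g n - 1‖⌋₊`, which lie in the
    -- closed image of `C`.
    have h2 : Tendsto (fun n => NormedSpace.exp
        (((⌊t * ‖(g n).val - 1‖⁻¹⌋₊ : ℝ) / ‖(g n).val - 1‖⁻¹) •
          (‖(g n).val - 1‖⁻¹ • l (g n).val))) atTop (𝓝 (NormedSpace.exp (t • X))) :=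
      (continuous_exp_real.tendsto _).comp (hk.smul hlog)
    refine (isClosed_image_val hC).mem_of_tendsto h2 ?_
    filter_upwards [hg1.eventually hexp] with n hn
    refine ⟨g n ^ ⌊t * ‖(g n).val - 1‖⁻¹⌋₊, C.pow_mem (hg n) _, ?_⟩
    have h0 : ‖(g n).val - 1‖⁻¹ ≠ 0 := by simpa [sub_eq_zero] using hne n
    rw [smul_smul, div_mul_cancel₀ _ h0, Nat.cast_smul_eq_nsmul, NormedSpace.exp_nsmul, hn]
    simp
  intro t
  rcases le_total 0 t with ht | ht
  · exact key t ht
  · obtain ⟨h, hh, he⟩ := key (-t) (by linarith)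
    refine ⟨h⁻¹, C.inv_mem hh, ?_⟩
    rw [Units.inv_eq_of_mul_eq_one_right]
    rw [he, neg_smul]
    exact exp_neg_mul_exp_self _

/-- The elements of a compact group `C` that are close to the identity belong to every closed
subgroup containing the one-parameter subgroups of `C`. -/
theorem exists_ball_subset_of_oneParam [ProperSpace A] {C S : Subgroup Aˣ}
    (hC : IsCompact (C : Set Aˣ)) (hS : IsClosed (S : Set Aˣ))
    (h : ∀ X ∈ oneParam C, ∀ g ∈ C, g.val = NormedSpace.exp X → g ∈ S) :
    ∃ ε > 0, ∀ g ∈ C, ‖g.val - 1‖ < ε → g ∈ S := by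
  by_contra! hcon
  -- Choose `g` closest to `1` in its coset of `C ⊓ S`; a correction by an element of `C ⊓ S` that
  -- brings it closer will be the contradiction.
  have hmin : ∀ n : ℕ, ∃ g ∈ C, g ∉ S ∧ ‖g.val - 1‖ < 1 / ((n : ℝ) + 1) ∧
      ∀ s ∈ C ⊓ S, ‖g.val - 1‖ ≤ ‖g.val * s.val - 1‖ := by
    intro n
    obtain ⟨g, hgC, hgn, hgS⟩ := hcon (1 / ((n : ℝ) + 1)) Nat.one_div_pos_of_nat
    have hK : IsCompact ((C ⊓ S : Subgroup Aˣ) : Set Aˣ) := hC.inter_right hS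
    obtain ⟨s, hs, hsmin⟩ := hK.exists_isMinOn ⟨1, one_mem (C ⊓ S)⟩
      (f := fun s => ‖g.val * s.val - 1‖)
      (((continuous_const.mul Units.continuous_val).sub continuous_const).norm.continuousOn)
    have hsmin' : ∀ s' ∈ C ⊓ S, ‖g.val * s.val - 1‖ ≤ ‖g.val * s'.val - 1‖ :=
      fun s' hs' => hsmin hs'
    refine ⟨g * s, C.mul_mem hgC hs.1, fun hgs => hgS ?_, ?_, fun s' hs' => ?_⟩
    · simpa using S.mul_mem hgs (S.inv_mem hs.2)
    · have := hsmin' 1 (one_mem _)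
      simp only [Units.val_one, mul_one] at this
      simpa using this.trans_lt hgn
    · simpa [mul_assoc] using hsmin' (s * s') (mul_mem hs hs')
  choose g hgC hgS hgn hgmin using hmin
  have hne : ∀ n, (g n).val ≠ 1 := fun n hn => hgS n (by
    rw [Units.val_eq_one.mp hn]; exact one_mem S)
  have hpos : ∀ n, 0 < ‖(g n).val - 1‖ := fun n => by simpa [sub_eq_zero] using hne n
  have h1 : Tendsto (fun n => (g n).val - 1) atTop (𝓝 0) :=
    squeeze_zero_norm (fun n => (hgn n).le) tendsto_one_div_add_atTop_nhds_zero_nat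
  obtain ⟨X, -, φ, hφ, hX⟩ := (isCompact_sphere (0 : A) 1).tendsto_subseq
    (x := fun n => ‖(g n).val - 1‖⁻¹ • ((g n).val - 1)) (fun n => by
      simp [norm_smul, (hpos n).ne'])
  have h1' := h1.comp hφ.tendsto_atTop
  have hXC : X ∈ oneParam C := mem_oneParam_of_tendsto hC (fun n => hgC (φ n))
    (fun n => hne (φ n)) h1' hX
  set r : ℕ → ℝ := fun n => ‖(g (φ n)).val - 1‖ with hr
  have hr0 : Tendsto r atTop (𝓝 0) := by simpa using h1'.norm
  have hrX0 : Tendsto (fun n => r n • X) atTop (𝓝 0) := by simpa using hr0.smul_const X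
  have hexpX : Tendsto (fun n => (r n)⁻¹ • (NormedSpace.exp (r n • X) - 1)) atTop (𝓝 X) := by
    have := (hasFDerivAt_exp_zero (𝕂 := ℝ) (𝔸 := A)).hasFDerivWithinAt (s := Set.univ) |>.lim
      (c := fun n => (r n)⁻¹) (v := X) hrX0 (by simp) (by
        refine tendsto_const_nhds.congr fun n => ?_
        rw [smul_smul, inv_mul_cancel₀ (hpos (φ n)).ne', one_smul])
    simpa [NormedSpace.exp_zero] using this
  have hdiff : Tendsto (fun n => (r n)⁻¹ • ((g (φ n)).val - NormedSpace.exp (r n • X)))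
      atTop (𝓝 0) := by
    have := hX.sub hexpX
    rw [sub_self] at this
    refine this.congr fun n => ?_
    simp only [Function.comp, ← smul_sub, hr]
    congr 1
    abel
  have hinv : Tendsto (fun n => NormedSpace.exp (-(r n • X))) atTop (𝓝 1) := by
    have := (continuous_exp_real (A := A)).tendsto (0 : A) |>.comp (by simpa using hrX0.neg)
    simpa [NormedSpace.exp_zero, Function.comp_def] using this
  have hprod := (hdiff.mul hinv).norm
  simp only [zero_mul, norm_zero] at hprod
  have hlt : ∀ᶠ n in atTop, ‖(r n)⁻¹ • ((g (φ n)).val - NormedSpace.exp (r n • X)) *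
      NormedSpace.exp (-(r n • X))‖ < 1 := hprod.eventually (gt_mem_nhds one_pos)
  -- The correction is `exp (-r n • X)`: it lies in `C ⊓ S` and moves `g (φ n)` to within `o(r n)`
  -- of `1`.
  obtain ⟨n, hn⟩ := hlt.exists
  obtain ⟨s, hsC, hs⟩ := hXC (-(r n))
  have hsS : s ∈ S := by
    refine h (-(r n) • X) (fun t => ?_) s hsC hs
    simpa [smul_smul] using hXC (t * -(r n))
  have hle := hgmin (φ n) s ⟨hsC, hsS⟩
  have hrn : 0 < r n := hpos (φ n)
  rw [smul_mul_assoc, norm_smul, sub_mul, exp_mul_exp_neg_self, ← neg_smul, ← hs, norm_inv,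
    Real.norm_of_nonneg hrn.le, inv_mul_lt_iff₀ hrn, mul_one] at hn
  exact absurd hn (not_lt.mpr hle)

/-- A compact connected group is contained in every closed subgroup containing its
one-parameter subgroups. -/
theorem le_of_oneParam [ProperSpace A] {C S : Subgroup Aˣ}
    (hC : IsCompact (C : Set Aˣ)) (hconn : IsConnected (C : Set Aˣ))
    (hS : IsClosed (S : Set Aˣ))
    (h : ∀ X ∈ oneParam C, ∀ g ∈ C, g.val = NormedSpace.exp X → g ∈ S) : C ≤ S := by
  obtain ⟨ε, hε, hball⟩ := exists_ball_subset_of_oneParam hC hS h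
  have : PreconnectedSpace C := isPreconnected_iff_preconnectedSpace.mp hconn.isPreconnected
  have hopen : IsOpen ((S.subgroupOf C : Subgroup C) : Set C) := by
    refine Subgroup.isOpen_of_mem_nhds (g := 1) _ ?_
    have hcont : Continuous fun g : C => ‖(g : Aˣ).val - 1‖ :=
      ((Units.continuous_val.comp continuous_subtype_val).sub continuous_const).norm
    have : {g : C | ‖(g : Aˣ).val - 1‖ < ε} ∈ 𝓝 (1 : C) :=
      (isOpen_lt hcont continuous_const).mem_nhds (by simpa using hε)
    exact mem_of_superset this fun g hg => hball g g.2 hg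
  have hclosed : IsClosed ((S.subgroupOf C : Subgroup C) : Set C) :=
    hS.preimage continuous_subtype_val
  have huniv : ((S.subgroupOf C : Subgroup C) : Set C) = Set.univ :=
    IsClopen.eq_univ ⟨hclosed, hopen⟩ ⟨1, one_mem _⟩
  intro g hg
  have : (⟨g, hg⟩ : C) ∈ ((S.subgroupOf C : Subgroup C) : Set C) := huniv ▸ Set.mem_univ _
  exact this

end Units

/-! ### Haar averaging and spanning images -/

section Averaging

variable {V : Type*} [NormedAddCommGroup V] [NormedSpace ℝ V] [FiniteDimensional ℝ V]

/-- If a compact group of linear maps has no nonzero fixed vector, then it fixes no nonzero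
linear functional. -/
theorem functional_eq_zero_of_invariant {C : Subgroup (V →L[ℝ] V)ˣ}
    (hC : IsCompact (C : Set (V →L[ℝ] V)ˣ))
    (hfix : ∀ v : V, (∀ g ∈ C, g.val v = v) → v = 0)
    {φ : V →L[ℝ] ℝ} (hφ : ∀ g ∈ C, ∀ v, φ (g.val v) = φ v) : φ = 0 := by
  let : MeasurableSpace C := borel C
  have : BorelSpace C := ⟨rfl⟩
  have : CompactSpace C := isCompact_iff_compactSpace.mp hC
  let ν : Measure C := Measure.haarMeasure ⊤
  have hν : ν Set.univ = 1 := Measure.haarMeasure_self (K₀ := ⊤)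
  have : IsProbabilityMeasure ν := ⟨hν⟩
  ext v
  have hcont : Continuous fun g : C => (g : (V →L[ℝ] V)ˣ).val v :=
    (Units.continuous_val.comp continuous_subtype_val).clm_apply continuous_const
  have hint : Integrable (fun g : C => (g : (V →L[ℝ] V)ˣ).val v) ν :=
    hcont.integrable_of_hasCompactSupport (HasCompactSupport.of_compactSpace _)
  -- The orbit average is fixed by `C`, hence zero, yet `φ` takes the same value on it as on `v`.
  have hw : (∫ g : C, (g : (V →L[ℝ] V)ˣ).val v ∂ν) = 0 := by
    refine hfix _ fun h hh => ?_
    rw [← ContinuousLinearMap.integral_comp_comm _ hint]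
    exact integral_mul_left_eq_self (fun g : C => (g : (V →L[ℝ] V)ˣ).val v) (⟨h, hh⟩ : C)
  have h2 : φ (∫ g : C, (g : (V →L[ℝ] V)ˣ).val v ∂ν) = φ v := by
    rw [← ContinuousLinearMap.integral_comp_comm _ hint]
    simp [hφ _ (Subtype.coe_prop _)]
  rw [← h2, hw]
  simp

/-- The derivative of `t ↦ φ (exp (t • X) v)` is `φ (X (exp (t • X) v)) = 0`. -/
theorem functional_apply_exp {V : Type*} [NormedAddCommGroup V] [NormedSpace ℝ V]
    [CompleteSpace V] {φ : V →L[ℝ] ℝ} {X : V →L[ℝ] V}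
    (h : ∀ v, φ (X v) = 0) (v : V) : φ (NormedSpace.exp X v) = φ v := by
  have hd : ∀ t : ℝ, HasDerivAt (fun t : ℝ => φ (NormedSpace.exp (t • X) v)) 0 t := by
    intro t
    have h1 := hasDerivAt_exp_smul_const' X t
    have h2 := φ.hasFDerivAt.comp_hasDerivAt t
      (((ContinuousLinearMap.apply ℝ V v).hasFDerivAt).comp_hasDerivAt t h1)
    simpa [h, Function.comp_def] using h2
  have := is_const_of_deriv_eq_zero (fun t => (hd t).differentiableAt) (fun t => (hd t).deriv) 1 0
  simpa [NormedSpace.exp_zero] using this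

/-- The images of the infinitesimal generators of a compact connected group without nonzero fixed
vectors are not all contained in one proper subspace. -/
theorem exists_oneParam_apply_notMem {C : Subgroup (V →L[ℝ] V)ˣ}
    (hC : IsCompact (C : Set (V →L[ℝ] V)ˣ)) (hconn : IsConnected (C : Set (V →L[ℝ] V)ˣ))
    (hfix : ∀ v : V, (∀ g ∈ C, g.val v = v) → v = 0)
    {U : Submodule ℝ V} (hU : U ≠ ⊤) : ∃ v, ∃ X ∈ oneParam C, X v ∉ U := by
  by_contra! hcon
  have : CompleteSpace V := FiniteDimensional.complete ℝ V
  obtain ⟨f, hf0, hfU⟩ := Submodule.exists_le_ker_of_lt_top U hU.lt_top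
  let φ : V →L[ℝ] ℝ := LinearMap.toContinuousLinearMap f
  let S : Subgroup (V →L[ℝ] V)ˣ :=
    { carrier := {g | ∀ v, φ (g.val v) = φ v}
      mul_mem' := fun {a b} ha hb v => by
        simpa using (ha (b.val v)).trans (hb v)
      one_mem' := fun v => by simp
      inv_mem' := fun {a} ha v => by
        have := ha (a⁻¹.val v)
        rw [← mul_apply_eq_comp, Units.mul_inv] at this
        simpa using this.symm }
  have hS : IsClosed (S : Set (V →L[ℝ] V)ˣ) := by
    have : (S : Set (V →L[ℝ] V)ˣ) = ⋂ v, {g | φ (g.val v) = φ v} := by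
      ext g; simp [S]
    rw [this]
    exact isClosed_iInter fun v => isClosed_eq
      (φ.continuous.comp (Units.continuous_val.clm_apply continuous_const)) continuous_const
  have hCS : C ≤ S := le_of_oneParam hC hconn hS fun X hX g _ hg v => by
    rw [hg]
    exact functional_apply_exp (φ := φ) (fun v => LinearMap.mem_ker.mp (hfU (hcon v X hX))) v
  have hφ : φ = 0 := functional_eq_zero_of_invariant hC hfix fun g hg v => hCS hg v
  exact hf0 (LinearMap.ext fun v => congrArg (fun ψ : V →L[ℝ] ℝ => ψ v) hφ)

end Averaging

/-! ### Generic tuples and sums of independent copies -/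

section Tuples

variable {V : Type*} [NormedAddCommGroup V] [NormedSpace ℝ V] [FiniteDimensional ℝ V]

theorem isOpen_linearIndependent_apply {V : Type*} [NormedAddCommGroup V] [NormedSpace ℝ V]
    {ι : Type*} [Finite ι] (X : ι → V →L[ℝ] V) :
    IsOpen {v : ι → V | LinearIndependent ℝ fun i => X i (v i)} :=
  isOpen_setOfPred_linearIndependent.preimage (by fun_prop)

theorem isOpen_exists_linearIndependent_apply {V : Type*} [NormedAddCommGroup V] [NormedSpace ℝ V]
    {ι : Type*} [Finite ι] (s : Set (V →L[ℝ] V)) :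
    IsOpen {v : ι → V | ∃ X : ι → V →L[ℝ] V, (∀ i, X i ∈ s) ∧
      LinearIndependent ℝ fun i => X i (v i)} := by
  have : {v : ι → V | ∃ X : ι → V →L[ℝ] V, (∀ i, X i ∈ s) ∧
      LinearIndependent ℝ fun i => X i (v i)} =
      ⋃ X ∈ {X : ι → V →L[ℝ] V | ∀ i, X i ∈ s},
        {v : ι → V | LinearIndependent ℝ fun i => X i (v i)} := by
    ext v; simp
  rw [this]
  exact isOpen_biUnion fun X _ => isOpen_linearIndependent_apply X

variable [MeasurableSpace V] [BorelSpace V]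

/-- For a measure not charging proper subspaces, the vectors of almost every tuple can be moved to
linearly independent ones by members of a family of maps whose images span. -/
theorem ae_exists_linearIndependent_apply {s : Set (V →L[ℝ] V)}
    (hs : ∀ U : Submodule ℝ V, U ≠ ⊤ → ∃ v, ∃ X ∈ s, X v ∉ U)
    (μ : Measure V) [IsProbabilityMeasure μ]
    (hsub : ∀ W : Submodule ℝ V, W ≠ ⊤ → μ (W : Set V) = 0)
    (k : ℕ) (hk : k ≤ Module.finrank ℝ V) :
    ∀ᵐ v ∂(Measure.pi fun _ : Fin k => μ), ∃ X : Fin k → V →L[ℝ] V, (∀ i, X i ∈ s) ∧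
      LinearIndependent ℝ fun i => X i (v i) := by
  induction k with
  | zero => exact Eventually.of_forall fun v => ⟨fun i => i.elim0, fun i => i.elim0,
      linearIndependent_empty_type⟩
  | succ k ih =>
    have hpres := measurePreserving_piFinSuccAbove (fun _ : Fin (k + 1) => μ) 0
    have hmeas : MeasurableSet {p : V × (Fin k → V) | ∃ X : Fin (k + 1) → V →L[ℝ] V,
        (∀ i, X i ∈ s) ∧ LinearIndependent ℝ
          fun i => X i ((Fin.cons p.1 p.2 : Fin (k + 1) → V) i)} := by
      exact ((isOpen_exists_linearIndependent_apply s).preimage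
        (continuous_fst.finCons continuous_snd)).measurableSet
    have hprod : ∀ᵐ p ∂(μ.prod (Measure.pi fun _ : Fin k => μ)),
        ∃ X : Fin (k + 1) → V →L[ℝ] V, (∀ i, X i ∈ s) ∧
          LinearIndependent ℝ fun i => X i ((Fin.cons p.1 p.2 : Fin (k + 1) → V) i) := by
      rw [Measure.ae_prod_iff_ae_ae hmeas, Measure.ae_ae_comm hmeas]
      filter_upwards [ih (by omega)] with w hw
      obtain ⟨X, hXs, hX⟩ := hw
      let U : Submodule ℝ V := Submodule.span ℝ (Set.range fun i => X i (w i))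
      have hU : U ≠ ⊤ := by
        intro h
        have h1 : Module.finrank ℝ U ≤ k := by
          simpa [Set.finrank] using finrank_range_le_card (R := ℝ) (fun i => X i (w i))
        rw [h, finrank_top] at h1
        omega
      -- The bad choices of the new vector: those that every map in `s` sends into the span `U`
      -- already reached.
      let W : Submodule ℝ V := ⨅ Y ∈ s, U.comap (Y : V →ₗ[ℝ] V)
      have hW : W ≠ ⊤ := by
        intro h
        obtain ⟨v, Y, hY, hYv⟩ := hs U hU
        have : v ∈ W := h ▸ Submodule.mem_top
        simp only [W, Submodule.mem_iInf] at this
        exact hYv (this Y hY)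
      have hae : ∀ᵐ v ∂μ, v ∉ W := measure_eq_zero_iff_ae_notMem.mp (hsub W hW)
      filter_upwards [hae] with v hv
      have : ∃ Y ∈ s, Y v ∉ U := by
        by_contra! hcon
        exact hv (by simpa [W, Submodule.mem_iInf] using hcon)
      obtain ⟨Y, hYs, hY⟩ := this
      refine ⟨Fin.cons Y X, Fin.cases hYs hXs, linearIndependent_finSucc.mpr ⟨hX, hY⟩⟩
    filter_upwards [hpres.quasiMeasurePreserving.ae hprod] with v hv
    obtain ⟨X, hXs, hX⟩ := hv
    refine ⟨X, hXs, ?_⟩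
    convert hX using 3 with i
    refine Fin.cases ?_ (fun i => ?_) i <;> rfl

/-- The `n`-th convolution power is the law of the sum of `n` independent copies. -/
theorem convPower_eq_map_sum (μ : Measure V) [IsProbabilityMeasure μ] (n : ℕ) :
    convPower μ n = (Measure.pi fun _ : Fin n => μ).map fun v => ∑ i, v i := by
  induction n with
  | zero =>
    simp only [convPower, Finset.univ_eq_empty, Finset.sum_empty, Measure.map_const, measure_univ,
      one_smul]
  | succ n ih =>
    have hpres := measurePreserving_piFinSuccAbove (fun _ : Fin (n + 1) => μ) 0
    have hsum : (fun v : Fin (n + 1) → V => ∑ i, v i) =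
        (fun p : V × V => p.1 + p.2) ∘ (Prod.map id fun v : Fin n → V => ∑ i, v i) ∘
          MeasurableEquiv.piFinSuccAbove (fun _ => V) 0 := by
      funext v
      simp [Fin.sum_univ_succ]
      rfl
    have hS : Measurable fun v : Fin n → V => ∑ i, v i := by fun_prop
    have : IsProbabilityMeasure ((Measure.pi fun _ : Fin n => μ).map fun v => ∑ i, v i) :=
      Measure.isProbabilityMeasure_map hS.aemeasurable
    -- Coordinate `0` is split off on the left while `convPower` appends on the right, hence
    -- `Measure.conv_comm`.
    rw [hsum, ← Measure.map_map (by fun_prop) (by fun_prop), ← Measure.map_map (by fun_prop)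
      (by fun_prop), hpres.map_eq, ← Measure.map_prod_map _ _ measurable_id hS, Measure.map_id,
      convPower, ih, Measure.conv_comm]
    rfl

end Tuples

/-! ### Absolute continuity and Fourier decay -/

section Density

/-- Away from its critical points, a strictly differentiable map pulls back null sets to null
sets. -/
theorem measure_eq_zero_of_maps_to_null {V : Type*} [NormedAddCommGroup V] [NormedSpace ℝ V]
    [FiniteDimensional ℝ V] [MeasurableSpace V] [BorelSpace V] (ν : Measure V)
    [ν.IsAddHaarMeasure] {f : V → V} {f' : V → V →L[ℝ] V} {s t : Set V} (hs : MeasurableSet s)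
    (hf : ∀ x ∈ s, HasStrictFDerivAt f (f' x) x) (hinj : ∀ x ∈ s, Function.Injective (f' x))
    (hst : Set.MapsTo f s t) (ht : ν t = 0) : ν s = 0 := by
  have : CompleteSpace V := FiniteDimensional.complete ℝ V
  refine measure_null_of_locally_null s fun x hx => ?_
  let e : V ≃L[ℝ] V :=
    (LinearEquiv.ofInjectiveEndo (f' x : V →ₗ[ℝ] V) (hinj x hx)).toContinuousLinearEquiv
  have he : HasStrictFDerivAt f (e : V →L[ℝ] V) x := by
    have : (e : V →L[ℝ] V) = f' x := by ext y; rfl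
    rw [this]
    exact hf x hx
  let Φ := he.toOpenPartialHomeomorph f
  refine ⟨s ∩ Φ.source, inter_mem self_mem_nhdsWithin (mem_nhdsWithin_of_mem_nhds
    (Φ.open_source.mem_nhds he.mem_toOpenPartialHomeomorph_source)), ?_⟩
  have hm : MeasurableSet (s ∩ Φ.source) := hs.inter Φ.open_source.measurableSet
  have hd : ∀ y ∈ s ∩ Φ.source, HasFDerivWithinAt f (f' y) (s ∩ Φ.source) y :=
    fun y hy => (hf y hy.1).hasFDerivAt.hasFDerivWithinAt
  have hI : Set.InjOn f (s ∩ Φ.source) := Φ.injOn.mono Set.inter_subset_right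
  -- The image is null, so the Jacobian vanishes almost everywhere on the piece, against injectivity
  -- of `f'`.
  have h0 := lintegral_abs_det_fderiv_eq_addHaar_image ν hm hd hI
  have him : ν (f '' (s ∩ Φ.source)) = 0 :=
    measure_mono_null (Set.image_subset_iff.mpr fun y hy => hst hy.1) ht
  rw [him, lintegral_eq_zero_iff' (aemeasurable_ofReal_abs_det_fderivWithin ν hm hd),
    Filter.EventuallyEq, ae_restrict_iff' hm] at h0
  refine measure_eq_zero_iff_ae_notMem.mpr ?_
  filter_upwards [h0] with y hy hys
  have hdet : (f' y).det = 0 := by simpa using hy hys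
  have hker := (LinearMap.bot_lt_ker_of_det_eq_zero (f := (f' y : V →ₗ[ℝ] V)) hdet).ne'
  exact hker (LinearMap.ker_eq_bot.mpr (hinj y hys.1))

variable {d : ℕ}

theorem hasStrictFDerivAt_sum_exp
    (X : Fin d → EuclideanSpace ℝ (Fin d) →L[ℝ] EuclideanSpace ℝ (Fin d))
    (v : Fin d → EuclideanSpace ℝ (Fin d)) (s : EuclideanSpace ℝ (Fin d)) :
    HasStrictFDerivAt (fun s : EuclideanSpace ℝ (Fin d) =>
        ∑ i, NormedSpace.exp (s i • X i) (v i))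
      (∑ i, (EuclideanSpace.proj i : EuclideanSpace ℝ (Fin d) →L[ℝ] ℝ).smulRight
        (X i (NormedSpace.exp (s i • X i) (v i)))) s := by
  refine HasStrictFDerivAt.fun_sum fun i _ => ?_
  have h1 := hasStrictDerivAt_exp_smul_const' (X i) (s i)
  have h2 := (ContinuousLinearMap.apply ℝ _ (v i)).hasStrictFDerivAt.comp_hasStrictDerivAt (s i) h1
  have h3 := h2.hasStrictFDerivAt.comp s
    (EuclideanSpace.proj i : EuclideanSpace ℝ (Fin d) →L[ℝ] ℝ).hasStrictFDerivAt
  refine h3.congr_fderiv ?_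
  ext c : 1
  simp

theorem injective_sum_smulRight {u : Fin d → EuclideanSpace ℝ (Fin d)}
    (hu : LinearIndependent ℝ u) : Function.Injective
      (∑ i, (EuclideanSpace.proj i : EuclideanSpace ℝ (Fin d) →L[ℝ] ℝ).smulRight (u i) :
        EuclideanSpace ℝ (Fin d) →L[ℝ] EuclideanSpace ℝ (Fin d)) := by
  refine (injective_iff_map_eq_zero _).mpr fun c hc => ?_
  have : ∑ i, c i • u i = 0 := by simpa [sum_apply] using hc
  ext i
  exact Fintype.linearIndependent_iff.mp hu (fun i => c i) this i

/-- Tuples that infinitesimal symmetries of the measure move in linearly independent directions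
almost never have their sum in a given null set. -/
theorem pi_sum_mem_null_eq_zero
    {X : Fin d → EuclideanSpace ℝ (Fin d) →L[ℝ] EuclideanSpace ℝ (Fin d)}
    {μ : Measure (EuclideanSpace ℝ (Fin d))} [IsProbabilityMeasure μ]
    (hinv : ∀ i, ∀ t : ℝ, μ.map (fun v => NormedSpace.exp (t • X i) v) = μ)
    {N : Set (EuclideanSpace ℝ (Fin d))} (hN : MeasurableSet N) (hN0 : volume N = 0) :
    Measure.pi (fun _ : Fin d => μ)
      {v | (LinearIndependent ℝ fun i => X i (v i)) ∧ ∑ i, v i ∈ N} = 0 := by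
  set B : Set (Fin d → EuclideanSpace ℝ (Fin d)) :=
    {v | (LinearIndependent ℝ fun i => X i (v i)) ∧ ∑ i, v i ∈ N} with hB
  have hBm : MeasurableSet B := (isOpen_linearIndependent_apply X).measurableSet.inter
    (hN.preimage (by fun_prop))
  let T : EuclideanSpace ℝ (Fin d) × (Fin d → EuclideanSpace ℝ (Fin d)) →
      Fin d → EuclideanSpace ℝ (Fin d) := fun p i => NormedSpace.exp (p.1 i • X i) (p.2 i)
  have hT : Continuous T := by
    refine continuous_pi fun i => ?_
    exact ((continuous_exp_real.comp (by fun_prop)).clm_apply (by fun_prop))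
  have hTB : MeasurableSet (T ⁻¹' B) := hBm.preimage hT.measurable
  -- Fubini: slices at fixed `s` all have the measure of `B`, while slices at fixed `v` are Lebesgue
  -- null.
  have hs : ∀ s, Measure.pi (fun _ : Fin d => μ) (Prod.mk s ⁻¹' (T ⁻¹' B)) =
      Measure.pi (fun _ : Fin d => μ) B := by
    intro s
    have hmap : (Measure.pi (fun _ : Fin d => μ)).map (fun v i => NormedSpace.exp (s i • X i) (v i))
        = Measure.pi fun _ : Fin d => μ := by
      have : ∀ i, SigmaFinite (μ.map fun v => NormedSpace.exp (s i • X i) v) := fun i => by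
        rw [hinv]; infer_instance
      rw [Measure.pi_map_pi (fun i => by fun_prop)]
      simp only [hinv]
    conv_rhs => rw [← hmap, Measure.map_apply (by fun_prop) hBm]
    rfl
  have hv : ∀ v, volume ((fun s => (s, v)) ⁻¹' (T ⁻¹' B)) = 0 := by
    intro v
    refine measure_eq_zero_of_maps_to_null volume (hTB.preimage (by fun_prop))
      (fun s _ => hasStrictFDerivAt_sum_exp X v s) (fun s hs => ?_) (fun s hs => hs.2) hN0
    exact injective_sum_smulRight hs.1
  have hprod : (volume.prod (Measure.pi fun _ : Fin d => μ)) (T ⁻¹' B) = 0 := by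
    rw [Measure.prod_apply_symm hTB]
    simp [hv]
  rw [Measure.prod_apply hTB] at hprod
  simp only [hs, lintegral_const, mul_eq_zero] at hprod
  exact hprod.resolve_right (NeZero.ne _)

/-- The characteristic function of an absolutely continuous finite measure vanishes at infinity. -/
theorem tendsto_charFun_cocompact_of_absolutelyContinuous {V : Type*} [NormedAddCommGroup V]
    [InnerProductSpace ℝ V] [FiniteDimensional ℝ V] [MeasurableSpace V] [BorelSpace V]
    {ν : Measure V} [IsFiniteMeasure ν] (hν : ν ≪ volume) :
    Tendsto (charFun ν) (cocompact V) (𝓝 0) := by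
  have h := tendsto_integral_exp_inner_smul_cocompact
    (fun v : V => ((ν.rnDeriv volume v).toReal : ℂ))
  -- This rescaling turns the kernel `exp (-2πi⟪v, w⟫)` into `exp (i⟪v, t⟫)`.
  have hc : (-(2 * Real.pi)⁻¹ : ℝ) ≠ 0 := by
    simp [Real.pi_ne_zero]
  have h2 := h.comp (Homeomorph.smulOfNeZero (α := V) _ hc).isClosedEmbedding.tendsto_cocompact
  refine h2.congr fun t => ?_
  rw [charFun_apply, ← integral_rnDeriv_smul hν]
  refine integral_congr_ae (Eventually.of_forall fun v => ?_)
  simp only [Homeomorph.smulOfNeZero_apply, inner_smul_right, Circle.smul_def, smul_eq_mul,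
    Real.fourierChar_apply, Complex.real_smul]
  rw [mul_comm]
  congr 2
  push_cast
  field_simp

theorem charFun_convPower {V : Type*} [NormedAddCommGroup V] [InnerProductSpace ℝ V]
    [FiniteDimensional ℝ V] [MeasurableSpace V] [BorelSpace V] (μ : Measure V)
    [IsProbabilityMeasure μ] (n : ℕ) (t : V) :
    IsProbabilityMeasure (convPower μ n) ∧ charFun (convPower μ n) t = charFun μ t ^ n := by
  induction n with
  | zero => exact ⟨by rw [convPower]; infer_instance, by simp [convPower]⟩
  | succ n ih =>
    have := ih.1
    exact ⟨by rw [convPower]; infer_instance, by rw [convPower, charFun_conv, ih.2, pow_succ]⟩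

end Density

theorem theorem3p2 (d : ℕ) (hd : 2 ≤ d)
    -- a compact connected subgroup of the topological group `GL(ℝ^d)`
    (C : Subgroup (EuclideanSpace ℝ (Fin d) →L[ℝ] EuclideanSpace ℝ (Fin d))ˣ)
    (hCcompact : IsCompact
      (C : Set (EuclideanSpace ℝ (Fin d) →L[ℝ] EuclideanSpace ℝ (Fin d))ˣ))
    (hCconn : IsConnected
      (C : Set (EuclideanSpace ℝ (Fin d) →L[ℝ] EuclideanSpace ℝ (Fin d))ˣ))
    -- without nonzero fixed points
    (hfix : ∀ v : EuclideanSpace ℝ (Fin d), (∀ g ∈ C, g.val v = v) → v = 0)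
    (μ : Measure (EuclideanSpace ℝ (Fin d))) [IsProbabilityMeasure μ]
    -- `μ` is invariant under the action of `C`
    (hinv : ∀ g ∈ C, μ.map g.val = μ)
    -- no proper vector subspace has positive measure
    (hsub : ∀ W : Submodule ℝ (EuclideanSpace ℝ (Fin d)), W ≠ ⊤ →
      μ (W : Set (EuclideanSpace ℝ (Fin d))) = 0) :
    (∃ f : EuclideanSpace ℝ (Fin d) → ENNReal, Measurable f ∧
      convPower μ d = volume.withDensity f) ∧
    Tendsto (charFun μ) (cocompact (EuclideanSpace ℝ (Fin d))) (𝓝 0) := by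
  have hprob : IsProbabilityMeasure (convPower μ d) := (charFun_convPower μ d 0).1
  have hac : convPower μ d ≪ volume := by
    refine Measure.AbsolutelyContinuous.mk fun N hN hN0 => ?_
    rw [convPower_eq_map_sum, Measure.map_apply (by fun_prop) hN]
    have hae := ae_exists_linearIndependent_apply
      (fun U hU => exists_oneParam_apply_notMem hCcompact hCconn hfix hU) μ hsub d (by simp)
    have hnull : Measure.pi (fun _ : Fin d => μ) {v | (∃ X : Fin d → EuclideanSpace ℝ (Fin d) →L[ℝ]
        EuclideanSpace ℝ (Fin d), (∀ i, X i ∈ oneParam C) ∧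
          LinearIndependent ℝ fun i => X i (v i)) ∧ ∑ i, v i ∈ N} = 0 := by
      -- There may be uncountably many choices of `X`, but each one works on an open set of tuples,
      -- so a local check suffices.
      refine measure_null_of_locally_null _ fun v hv => ?_
      obtain ⟨⟨X, hXC, hX⟩, -⟩ := hv
      refine ⟨_, ?_, pi_sum_mem_null_eq_zero (X := X) (μ := μ) (fun i t => ?_) hN hN0⟩
      · filter_upwards [self_mem_nhdsWithin, mem_nhdsWithin_of_mem_nhds
          ((isOpen_linearIndependent_apply X).mem_nhds hX)] with w hw hwX
        exact ⟨hwX, hw.2⟩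
      · obtain ⟨g, hg, hgt⟩ := hXC i t
        rw [← hgt]
        exact hinv g hg
    refine measure_eq_zero_iff_ae_notMem.mpr ?_
    filter_upwards [hae, measure_eq_zero_iff_ae_notMem.mp hnull] with v hv hv' hvN
    exact hv' ⟨hv, hvN⟩
  refine ⟨⟨(convPower μ d).rnDeriv volume, Measure.measurable_rnDeriv _ _,
    (Measure.withDensity_rnDeriv_eq _ _ hac).symm⟩, ?_⟩
  have h := (tendsto_charFun_cocompact_of_absolutelyContinuous hac).norm
  have h' : Tendsto (fun t => ‖charFun μ t‖ ^ d) (cocompact _) (𝓝 0) := by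
    simpa [(charFun_convPower μ d _).2] using h
  have hd0 : d ≠ 0 := by omega
  rw [tendsto_zero_iff_norm_tendsto_zero]
  have h3 := h'.rpow_const (p := (d : ℝ)⁻¹) (Or.inr (by positivity))
  simpa [Real.pow_rpow_inv_natCast (norm_nonneg _) hd0, hd0] using h3
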